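/- Let $\mathcal H_P$ and $\mathcal H_A$ be finite-dimensional Hilbert spaces (a probe and a noiseless ancilla), let $H$ be a Hermitian operator and $L_1,\dots,L_r$ arbitrary operators on $\mathcal H_P$, and let $\mathcal S$ be the real vector space of all Hermitian operators in the linear span of $\mathbb 1, L_i, L_i^\dagger, L_i^\dagger L_j$ ($1\le i,j\le r$). Write $\|H-\mathcal S\|=\min_{S\in\mathcal S}\|H-S\|$ in operator norm. Let $\rho_0,\rho_1$ be density operators on $\mathcal H_P$ with $\mathrm{Tr}(\rho_0\rho_1)=0$, $\mathrm{Tr}((\rho_0-\rho_1)H)=2\|H-\mathcal S\|$, and $\mathrm{Tr}((\rho_0-\rho_1)S)=0$ for all $S\in\mathcal S$. Let $Q_0,Q_1$ be traceless Hermitian operators on $\mathcal H_P$ with $\mathrm{Tr}(Q_kL_i)=0$ for all $k,i$. Let $m\ge 2$, and let $|0_L\rangle,|1_L\rangle\in\mathcal H_P^{\otimes m}\otimes\mathcal H_A$ be orthonormal vectors such that, for all $k,k'\in\{0,1\}$ and all $\ell\ne\ell'$ in $\{1,\dots,m\}$, $$\mathrm{Tr}_{\backslash\{\ell,\ell'\}}\big(|k_L\rangle\langle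 k'_L|\big)=\big(\rho_k\otimes\rho_k-Q_k\otimes Q_k\big)\,\delta_{kk'},$$ where $\mathrm{Tr}_{\backslash\{\ell,\ell'\}}$ is the partial trace over the ancilla and all probes except the $\ell$-th and the $\ell'$-th. Put $P=|0_L\rangle\langle 0_L|+|1_L\rangle\langle 1_L|$, $P_\perp=\mathbb 1-P$ and $Z_L=|0_L\rangle\langle 0_L|-|1_L\rangle\langle 1_L|$. For real $\omega$ let the probes and the ancilla evolve by the master equation $\frac{d\sigma}{dt}=\mathcal L_\omega(\sigma)$, $$\mathcal L_\omega(\sigma)=-i\Big[\omega\sum_{\ell=1}^m H^{(\ell)},\sigma\Big]+\sum_{i=1}^r\sum_{\ell=1}^m\Big(L_i^{(\ell)}\sigma L_i^{(\ell)\dagger}-\tfrac12\big\{L_i^{(\ell)\dagger}L_i^{(\ell)},\sigma\big\}\Big),$$ where $X^{(\ell)}$ is the operator $X$ acting on the $\ell$-th probe. Then there is a recovery channel $\mathcal R$, that is, a quantum channel (completely positive trace-preserving map) on $\mathcal H_P^{\otimes m}\otimes\mathcal H_A$ with $P\,\mathcal R(X)\,P=\mathcal R(X)$ for all $X$, not depending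 on $\omega$, such that frequent application of the QEC operation $\mathcal C(\sigma)=P\sigma P+\mathcal R(P_\perp\sigma P_\perp)$ makes the logical state evolve, up to an arbitrarily small error, by the noiseless equation $$\frac{d\rho_L}{dt}=-i\big[\omega\, m\,\|H-\mathcal S\|\,Z_L,\ \rho_L\big].$$ Precisely: for all real $\omega$ and $T$ and every $\varepsilon>0$ there is a $\delta>0$ such that, for every density operator $\sigma_0=P\sigma_0P$, the solution $\rho_L$ of this equation with $\rho_L(0)=\sigma_0$ satisfies $$\big\|\big(\mathcal C\circ e^{\tau\mathcal L_\omega}\big)^N(\sigma_0)-\rho_L(N\tau)\big\|\le\varepsilon$$ for all $0<\tau\le\delta$ and all integers $N\ge0$ with $N\tau\le T$. -/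

import Mathlib

open scoped Matrix Kronecker ComplexConjugate ComplexOrder Matrix.Norms.L2Operator

noncomputable section

namespace MultiProbe

/-! Throughout, operators on a finite-dimensional Hilbert space with a fixed orthonormal basis
indexed by `n` are matrices `Matrix n n ℂ`, and `‖·‖` on them is the operator norm (the norm
of the induced map on `EuclideanSpace ℂ n`). -/

/-- A density operator: positive semidefinite of unit trace. -/
def IsDensity {n : Type*} [Fintype n] (σ : Matrix n n ℂ) : Prop :=
  σ.PosSemidef ∧ σ.trace = 1

/-- The ket-bra `|u⟩⟨v|`. -/
def ketBra {n : Type*} (u v : EuclideanSpace ℂ n) : Matrix n n ℂ :=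
  Matrix.of fun x y => u x * conj (v y)

/-- The commutator `[X, Y] = X Y - Y X`. -/
def comm {n : Type*} [Fintype n] (X Y : Matrix n n ℂ) : Matrix n n ℂ := X * Y - Y * X

/-- The right-hand side of the Markovian (Lindblad) master equation with Hamiltonian `G` and
jump operators `J k`:
`σ ↦ -i[G, σ] + ∑ k, (J k σ (J k)† - ½ {(J k)† J k, σ})`. -/
def lindbladian {n κ : Type*} [Fintype n] [Fintype κ]
    (G : Matrix n n ℂ) (J : κ → Matrix n n ℂ) : Matrix n n ℂ →ₗ[ℂ] Matrix n n ℂ where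
  toFun σ := (-Complex.I) • comm G σ
    + ∑ k, (J k * σ * (J k)ᴴ
        - (1 / 2 : ℂ) • ((J k)ᴴ * J k * σ + σ * ((J k)ᴴ * J k)))
  map_add' σ σ' := by
    simp only [comm, Matrix.mul_add, Matrix.add_mul, smul_add, smul_sub,
      Finset.sum_add_distrib, Finset.sum_sub_distrib]
    abel
  map_smul' c σ := by
    simp only [comm, Matrix.mul_smul, Matrix.smul_mul, RingHom.id_apply, smul_add, smul_sub,
      Finset.smul_sum, Finset.sum_add_distrib, Finset.sum_sub_distrib,
      smul_comm c]

/-- A linear map on `n × n` matrices, as the continuous linear map that it is. -/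
def toCLM {n : Type*} [Fintype n] [DecidableEq n]
    (𝓛 : Matrix n n ℂ →ₗ[ℂ] Matrix n n ℂ) : Matrix n n ℂ →L[ℂ] Matrix n n ℂ :=
  ⟨𝓛, LinearMap.continuous_of_finiteDimensional 𝓛⟩

/-- The evolution for time `t` generated by the master equation `dσ/dt = 𝓛 σ`: the linear map
`exp (t 𝓛)`, where the exponential is taken in the algebra, under composition, of the linear
maps on `n × n` matrices. -/
def evolve {n : Type*} [Fintype n] [DecidableEq n]
    (𝓛 : Matrix n n ℂ →ₗ[ℂ] Matrix n n ℂ) (t : ℝ) : Matrix n n ℂ →L[ℂ] Matrix n n ℂ :=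
  NormedSpace.exp (t • toCLM 𝓛)

/-- `t ↦ evolve 𝓛 t σ` solves the master equation with initial value `σ`. -/
theorem evolve_spec {n : Type*} [Fintype n] [DecidableEq n]
    (𝓛 : Matrix n n ℂ →ₗ[ℂ] Matrix n n ℂ) (σ : Matrix n n ℂ) :
    evolve 𝓛 0 σ = σ ∧
      ∀ t : ℝ, HasDerivAt (fun s : ℝ => evolve 𝓛 s σ) (𝓛 (evolve 𝓛 t σ)) t := by
  refine ⟨?_, fun t => ?_⟩
  · have h : evolve 𝓛 0 = 1 := by
      unfold evolve
      have h0 : (0 : ℝ) • toCLM 𝓛 = 0 := zero_smul ℝ (toCLM 𝓛)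
      rw [h0]
      exact NormedSpace.exp_zero
    rw [h]
    rfl
  · have h := hasDerivAt_exp_smul_const' (𝕂 := ℝ) (toCLM 𝓛) t
    exact ((ContinuousLinearMap.apply ℂ (Matrix n n ℂ) σ).restrictScalars
      ℝ).hasFDerivAt.comp_hasDerivAt t h

/-- A quantum channel (completely positive trace-preserving map), in operator-sum form. -/
def IsChannel {n : Type*} [Fintype n] [DecidableEq n]
    (R : Matrix n n ℂ →ₗ[ℂ] Matrix n n ℂ) : Prop :=
  ∃ (s : ℕ) (K : Fin s → Matrix n n ℂ),
    ∑ j, (K j)ᴴ * K j = 1 ∧ ∀ X, R X = ∑ j, K j * X * (K j)ᴴ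

/-! ### The single probe -/

section SingleProbe

variable {P : Type*} [Fintype P] [DecidableEq P] {r : ℕ}

/-- The Lindblad span: the real-linear space of all Hermitian operators in the linear span
of `1, L i, (L i)†, (L i)† L j`. -/
def lindbladSpan (L : Fin r → Matrix P P ℂ) : Submodule ℝ (Matrix P P ℂ) :=
  (Submodule.span ℂ
    ({1} ∪ Set.range L ∪ Set.range (fun i => (L i)ᴴ)
      ∪ Set.range (fun ij : Fin r × Fin r => (L ij.1)ᴴ * L ij.2))).restrictScalars ℝ
  ⊓ selfAdjoint.submodule ℝ (Matrix P P ℂ)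

/-- `‖H - 𝓢‖ = min_{S ∈ 𝓢} ‖H - S‖` in operator norm, for the Lindblad span `𝓢` of `L`. -/
def distSpan (H : Matrix P P ℂ) (L : Fin r → Matrix P P ℂ) : ℝ :=
  Metric.infDist H (lindbladSpan L : Set (Matrix P P ℂ))

/-- A pair `ρ 0, ρ 1` of orthogonal density operators of the probe with
`Tr((ρ 0 - ρ 1) H) = 2 ‖H - 𝓢‖` and `Tr((ρ 0 - ρ 1) S) = 0` for all `S ∈ 𝓢`. -/
structure IsOptimalPair (H : Matrix P P ℂ) (L : Fin r → Matrix P P ℂ)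
    (ρ : Fin 2 → Matrix P P ℂ) : Prop where
  density : ∀ k, IsDensity (ρ k)
  orthogonal : (ρ 0 * ρ 1).trace = 0
  signal : ((ρ 0 - ρ 1) * H).trace = ((2 * distSpan H L : ℝ) : ℂ)
  noise : ∀ S ∈ lindbladSpan L, ((ρ 0 - ρ 1) * S).trace = 0

end SingleProbe

/-! ### `m` probes and a noiseless ancilla

The space `ℋ_P^{⊗ m} ⊗ ℋ_A` has its product basis indexed by `(Fin m → P) × A`. -/

section MultiProbe

variable {P A : Type*} [Fintype P] [DecidableEq P] [Fintype A] [DecidableEq A] {r m : ℕ}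

/-- `X^{(ℓ)}`: the operator `X` acting on the `ℓ`-th probe, and as the identity on all other
probes and on the ancilla. -/
def onProbe (ℓ : Fin m) (X : Matrix P P ℂ) :
    Matrix ((Fin m → P) × A) ((Fin m → P) × A) ℂ :=
  Matrix.of fun x y =>
    if x.2 = y.2 ∧ ∀ j, j ≠ ℓ → x.1 j = y.1 j then X (x.1 ℓ) (y.1 ℓ) else 0

/-- `Tr_{∖{ℓ,ℓ'}} M` (for `ℓ ≠ ℓ'`): the partial trace over the ancilla and over all probes
but the `ℓ`-th and the `ℓ'`-th. The `((a, b), (a', b'))` entry is the sum of the entries of `M`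
whose row has `a, b` and whose column has `a', b'` in positions `ℓ, ℓ'`, with equal row and
column indices in all other positions and in the ancilla. -/
def reduceTwo (ℓ ℓ' : Fin m) (M : Matrix ((Fin m → P) × A) ((Fin m → P) × A) ℂ) :
    Matrix (P × P) (P × P) ℂ :=
  Matrix.of fun a b => ∑ x : Fin m → P, ∑ α : A,
    if x ℓ = a.1 ∧ x ℓ' = a.2 then
      M (x, α) (Function.update (Function.update x ℓ b.1) ℓ' b.2, α)
    else 0

/-- The generator of the dynamics of `m` probes and the ancilla, where each probe is subject to
the Hamiltonian `ω H` and to the noise `L`, and the ancilla to neither. -/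
def probesGenerator (H : Matrix P P ℂ) (L : Fin r → Matrix P P ℂ) (ω : ℝ) :
    Matrix ((Fin m → P) × A) ((Fin m → P) × A) ℂ →ₗ[ℂ]
      Matrix ((Fin m → P) × A) ((Fin m → P) × A) ℂ :=
  lindbladian ((ω : ℂ) • ∑ ℓ : Fin m, onProbe ℓ H)
    (fun iℓ : Fin r × Fin m => onProbe iℓ.2 (L iℓ.1))

end MultiProbe

/-! ### Error correction with a two-dimensional code -/

section Code

variable {n : Type*} [Fintype n] [DecidableEq n]

/-- The projection `|0_L⟩⟨0_L| + |1_L⟩⟨1_L|` onto the code space. -/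
def codeProj (ψ : Fin 2 → EuclideanSpace ℂ n) : Matrix n n ℂ :=
  ketBra (ψ 0) (ψ 0) + ketBra (ψ 1) (ψ 1)

/-- The logical Pauli-Z operator `|0_L⟩⟨0_L| - |1_L⟩⟨1_L|`. -/
def logicalZ (ψ : Fin 2 → EuclideanSpace ℂ n) : Matrix n n ℂ :=
  ketBra (ψ 0) (ψ 0) - ketBra (ψ 1) (ψ 1)

/-- A logical state: a density operator supported on the code space. -/
def IsLogicalState (ψ : Fin 2 → EuclideanSpace ℂ n) (σ : Matrix n n ℂ) : Prop :=
  IsDensity σ ∧ codeProj ψ * σ * codeProj ψ = σ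

/-- A recovery channel `R`: a quantum channel whose outputs lie in the code space. -/
def IsRecovery (ψ : Fin 2 → EuclideanSpace ℂ n)
    (R : Matrix n n ℂ →ₗ[ℂ] Matrix n n ℂ) : Prop :=
  IsChannel R ∧ ∀ X, codeProj ψ * R X * codeProj ψ = R X

/-- The QEC operation `𝒫 + R ∘ 𝒫_⊥`: measure whether the state is in the code space, and apply
the recovery `R` if it is not. -/
def qecOperation (ψ : Fin 2 → EuclideanSpace ℂ n)
    (R : Matrix n n ℂ →ₗ[ℂ] Matrix n n ℂ) (σ : Matrix n n ℂ) : Matrix n n ℂ :=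
  codeProj ψ * σ * codeProj ψ + R ((1 - codeProj ψ) * σ * (1 - codeProj ψ))

/-- The state at time `N τ` under the dynamics generated by `𝓛`, when the QEC operation is
applied instantaneously at the times `τ, 2τ, …, N τ`. -/
def qecState (ψ : Fin 2 → EuclideanSpace ℂ n)
    (R 𝓛 : Matrix n n ℂ →ₗ[ℂ] Matrix n n ℂ) (τ : ℝ) (N : ℕ) (σ : Matrix n n ℂ) :
    Matrix n n ℂ :=
  (fun σ' => qecOperation ψ R (evolve 𝓛 τ σ'))^[N] σ

end Code

end MultiProbe

end

/-!
Since `Tr (Q k) = 0` and `Tr (Q k * L i) = 0`, the correction `Q k ⊗ Q k` to the two-probe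
marginals is invisible to the noise: the matrix elements on the code of `L^(ℓ)` and of
`L^(ℓ)† L'^(ℓ')` are those of a product state `ρ k ⊗ ρ k`, which do not depend on `k` because
`ρ 0 - ρ 1` is orthogonal to the Lindblad span. So the Knill–Laflamme conditions hold and some
recovery undoes the noise to first order in the time step. The Hamiltonian, on the other hand,
compresses to a multiple of `P` plus `ω m Tr((ρ 0 - ρ 1) H) / 2 = ω m ‖H - 𝓢‖` times `Z_L`.
Passing from the first-order statement to finite times is a product formula of quantum Zeno type.
-/

namespace MultiProbe

section Zeno

open NormedSpace Asymptotics Topology Filter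

variable {𝔸 : Type*} [NormedRing 𝔸]

theorem norm_pow_sub_pow_mul_le {f g q : 𝔸} {α γ : ℝ} (hqq : q * q = q) (hqf : q * f = f)
    (hfg : ‖(f - g) * q‖ ≤ α) (hg : ‖g‖ ≤ γ) (n : ℕ) :
    ‖(f ^ n - g ^ n) * q‖ ≤ ((γ + α) ^ n - γ ^ n) * ‖q‖ := by
  have hqfn : ∀ n : ℕ, q * (f ^ n * q) = f ^ n * q := by
    rintro (_ | n)
    · rw [pow_zero, one_mul, hqq]
    · rw [pow_succ', ← mul_assoc, ← mul_assoc, hqf]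
  have hgn : ∀ n : ℕ, ‖g ^ n * q‖ ≤ γ ^ n * ‖q‖ := fun n => by
    induction n with
    | zero => simp
    | succ n ih =>
      rw [pow_succ', mul_assoc, pow_succ', mul_assoc]
      exact norm_mul_le_of_le hg ih
  induction n with
  | zero => simp
  | succ n ih =>
    have hsplit : (f ^ (n + 1) - g ^ (n + 1)) * q
        = (f - g) * q * ((f ^ n - g ^ n) * q + g ^ n * q) + g * ((f ^ n - g ^ n) * q) := by
      rw [← add_mul, sub_add_cancel, mul_assoc (f - g), hqfn, pow_succ', pow_succ']
      noncomm_ring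
    calc ‖(f ^ (n + 1) - g ^ (n + 1)) * q‖
        ≤ α * (((γ + α) ^ n - γ ^ n) * ‖q‖ + γ ^ n * ‖q‖)
            + γ * (((γ + α) ^ n - γ ^ n) * ‖q‖) := by
          rw [hsplit]
          exact norm_add_le_of_le (norm_mul_le_of_le hfg (norm_add_le_of_le ih (hgn n)))
            (norm_mul_le_of_le hg ih)
      _ = ((γ + α) ^ (n + 1) - γ ^ (n + 1)) * ‖q‖ := by ring

variable [NormedAlgebra ℝ 𝔸] [CompleteSpace 𝔸]

theorem norm_exp_le_exp_norm [NormOneClass 𝔸] (a : 𝔸) : ‖exp a‖ ≤ Real.exp ‖a‖ := by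
  have hexp := exp_series_hasSum_exp' (𝕂 := ℝ) ‖a‖
  rw [← Real.exp_eq_exp_ℝ] at hexp
  refine (exp_series_hasSum_exp' (𝕂 := ℝ) a).norm_le_of_bounded hexp fun k => ?_
  rw [norm_smul, Real.norm_of_nonneg (by positivity), smul_eq_mul]
  gcongr
  exact norm_pow_le a k

theorem isLittleO_mul_exp_smul_sub_exp_smul_mul {a c d q : 𝔸} (hcq : c * q = q)
    (hcaq : c * a * q = d * q) :
    (fun τ : ℝ => (c * exp (τ • a) - exp (τ • d)) * q) =o[𝓝 0] fun τ => τ := by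
  have ha := (hasDerivAt_exp_smul_const (𝕂 := ℝ) a 0).const_mul c
  have hd := hasDerivAt_exp_smul_const (𝕂 := ℝ) d 0
  have h := hasDerivAt_iff_isLittleO_nhds_zero.1 ((ha.sub hd).mul_const q)
  simpa [sub_mul, hcq, hcaq, ← mul_assoc] using h

theorem exp_add_mul_pow_sub_exp_pow_le {k η τ T : ℝ} {N : ℕ} (hk : 0 ≤ k) (hη : 0 ≤ η)
    (hτ : 0 ≤ τ) (hN : N * τ ≤ T) :
    (Real.exp (τ * k) + η * τ) ^ N - Real.exp (τ * k) ^ N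
      ≤ Real.exp (T * k) * (Real.exp (T * η) - 1) := by
  have hadd : Real.exp (τ * k) + η * τ ≤ Real.exp (τ * k) * Real.exp (τ * η) := by
    have h1 : 1 ≤ Real.exp (τ * k) := Real.one_le_exp (by positivity)
    have h2 : τ * η + 1 ≤ Real.exp (τ * η) := Real.add_one_le_exp _
    nlinarith [mul_nonneg hτ hη]
  calc (Real.exp (τ * k) + η * τ) ^ N - Real.exp (τ * k) ^ N
      ≤ (Real.exp (τ * k) * Real.exp (τ * η)) ^ N - Real.exp (τ * k) ^ N := by gcongr
    _ = Real.exp (N * τ * k) * (Real.exp (N * τ * η) - 1) := by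
        simp only [mul_pow, ← Real.exp_nat_mul, mul_assoc]
        ring
    _ ≤ Real.exp (T * k) * (Real.exp (T * η) - 1) := by
        have : 0 ≤ Real.exp (N * τ * η) - 1 := sub_nonneg.2 (Real.one_le_exp (by positivity))
        gcongr

/-- A quantum Zeno product formula: `c` is the operation that repeatedly interrupts the evolution
generated by `a`, and `q` an idempotent onto its range. -/
theorem exists_norm_pow_mul_exp_smul_sub_exp_smul_mul_le [NormOneClass 𝔸] {a c d q : 𝔸}
    (hqq : q * q = q) (hcq : c * q = q) (hqc : q * c = c) (hcaq : c * a * q = d * q)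
    (T : ℝ) {ε : ℝ} (hε : 0 < ε) :
    ∃ δ > 0, ∀ (τ : ℝ) (N : ℕ), 0 < τ → τ ≤ δ → N * τ ≤ T →
      ‖((c * exp (τ • a)) ^ N - exp ((N * τ) • d)) * q‖ ≤ ε := by
  obtain ⟨η, hηε, hη⟩ : ∃ η : ℝ,
      Real.exp (T * ‖d‖) * (Real.exp (T * η) - 1) * ‖q‖ < ε ∧ 0 < η := by
    have hcont : Tendsto (fun η => Real.exp (T * ‖d‖) * (Real.exp (T * η) - 1) * ‖q‖)
        (𝓝[>] 0) (𝓝 0) :=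
      Continuous.tendsto' (by fun_prop) _ _ (by simp) |>.mono_left nhdsWithin_le_nhds
    exact ((hcont.eventually_lt_const hε).and self_mem_nhdsWithin).exists
  obtain ⟨δ, hδ, hstep⟩ := Metric.eventually_nhds_iff_ball.1
    ((isLittleO_mul_exp_smul_sub_exp_smul_mul hcq hcaq).def hη)
  refine ⟨δ / 2, half_pos hδ, fun τ N hτ hτδ hN => ?_⟩
  have hfirst : ‖(c * exp (τ • a) - exp (τ • d)) * q‖ ≤ η * τ := by
    have hball : τ ∈ Metric.ball 0 δ := by
      rw [mem_ball_zero_iff, Real.norm_of_nonneg hτ.le]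
      linarith
    simpa [abs_of_pos hτ] using hstep τ hball
  have hexp : ‖exp (τ • d)‖ ≤ Real.exp (τ * ‖d‖) := by
    simpa [norm_smul, abs_of_pos hτ] using norm_exp_le_exp_norm (τ • d)
  have hpow : exp ((N * τ) • d) = exp (τ • d) ^ N := by
    let : NormedAlgebra ℚ 𝔸 := .restrictScalars ℚ ℝ 𝔸
    rw [← exp_nsmul, mul_smul, Nat.cast_smul_eq_nsmul]
  calc ‖((c * exp (τ • a)) ^ N - exp ((N * τ) • d)) * q‖
      ≤ ((Real.exp (τ * ‖d‖) + η * τ) ^ N - Real.exp (τ * ‖d‖) ^ N) * ‖q‖ := by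
        rw [hpow]
        exact norm_pow_sub_pow_mul_le hqq (by rw [← mul_assoc, hqc]) hfirst hexp N
    _ ≤ Real.exp (T * ‖d‖) * (Real.exp (T * η) - 1) * ‖q‖ := by
        gcongr
        exact exp_add_mul_pow_sub_exp_pow_le (norm_nonneg d) hη.le hτ.le hN
    _ ≤ ε := hηε.le

end Zeno

section Code

variable {n : Type*}

theorem conjTranspose_ketBra (u v : EuclideanSpace ℂ n) : (ketBra u v)ᴴ = ketBra v u := by
  ext x y
  simp [ketBra, mul_comm]

variable [Fintype n]

theorem trace_ketBra (u v : EuclideanSpace ℂ n) : (ketBra u v).trace = inner ℂ v u := by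
  simp [ketBra, Matrix.trace, PiLp.inner_apply]

theorem ketBra_mul_mul_ketBra (u v w z : EuclideanSpace ℂ n) (X : Matrix n n ℂ) :
    ketBra u v * X * ketBra w z = (ketBra w v * X).trace • ketBra u z := by
  have hketBra (a b : EuclideanSpace ℂ n) : ketBra a b = Matrix.vecMulVec a.ofLp (star b.ofLp) :=
    rfl
  simp only [hketBra, Matrix.vecMulVec_mul, Matrix.vecMul_vecMulVec, Matrix.trace_vecMulVec,
    Matrix.vecMulVec_smul, dotProduct_comm]

theorem ketBra_mul_ketBra (u v w z : EuclideanSpace ℂ n) :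
    ketBra u v * ketBra w z = inner ℂ v w • ketBra u z := by
  classical
  simpa only [mul_one, trace_ketBra] using ketBra_mul_mul_ketBra u v w z 1

variable {ψ : Fin 2 → EuclideanSpace ℂ n}

theorem trace_codeProj (hψ : Orthonormal ℂ ψ) : (codeProj ψ).trace = 2 := by
  simp only [codeProj, Matrix.trace_add, trace_ketBra, orthonormal_iff_ite.1 hψ]
  norm_num

theorem codeProj_mul_mul_codeProj {X : Matrix n n ℂ} {f : Fin 2 → ℂ}
    (hX : ∀ k k', (ketBra (ψ k) (ψ k') * X).trace = if k = k' then f k else 0) :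
    codeProj ψ * X * codeProj ψ
      = ((f 0 + f 1) / 2) • codeProj ψ + ((f 0 - f 1) / 2) • logicalZ ψ := by
  have hdiag : codeProj ψ * X * codeProj ψ
      = f 0 • ketBra (ψ 0) (ψ 0) + f 1 • ketBra (ψ 1) (ψ 1) := by
    simp [codeProj, mul_add, add_mul, ketBra_mul_mul_ketBra, hX]
  rw [hdiag, codeProj, logicalZ]
  module

theorem codeProj_mul_ketBra (hψ : Orthonormal ℂ ψ) (k : Fin 2) (v : EuclideanSpace ℂ n) :
    codeProj ψ * ketBra (ψ k) v = ketBra (ψ k) v := by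
  fin_cases k <;>
    simp [codeProj, add_mul, ketBra_mul_ketBra, orthonormal_iff_ite.1 hψ,
      -inner_self_eq_norm_sq_to_K]

theorem isStarProjection_codeProj (hψ : Orthonormal ℂ ψ) : IsStarProjection (codeProj ψ) where
  isIdempotentElem := by
    rw [IsIdempotentElem]
    nth_rw 2 3 [codeProj]
    simp only [mul_add, codeProj_mul_ketBra hψ]
  isSelfAdjoint := by
    rw [IsSelfAdjoint, Matrix.star_eq_conjTranspose]
    simp only [codeProj, Matrix.conjTranspose_add, conjTranspose_ketBra]

end Code

section OnProbe

variable {P A : Type*} {m : ℕ}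

/-- The index of the `ℓ`-th probe, separated from that of the other probes and the ancilla:
under it `onProbe ℓ X` becomes `X ⊗ 1`. -/
def probeSplit (ℓ : Fin m) : (Fin m → P) × A ≃ P × ({j // j ≠ ℓ} → P) × A :=
  ((Equiv.funSplitAt ℓ P).prodCongr (Equiv.refl A)).trans (Equiv.prodAssoc _ _ _)

variable [DecidableEq P] [DecidableEq A]

theorem onProbe_eq_submatrix (ℓ : Fin m) (X : Matrix P P ℂ) :
    (onProbe ℓ X : Matrix ((Fin m → P) × A) ((Fin m → P) × A) ℂ)
      = (X ⊗ₖ (1 : Matrix (({j // j ≠ ℓ} → P) × A) (({j // j ≠ ℓ} → P) × A) ℂ)).submatrix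
          (probeSplit ℓ) (probeSplit ℓ) := by
  ext x y
  simp [onProbe, probeSplit, Matrix.one_apply, Prod.ext_iff, funext_iff, and_comm]

theorem onProbe_one (ℓ : Fin m) :
    onProbe ℓ (1 : Matrix P P ℂ) = (1 : Matrix ((Fin m → P) × A) ((Fin m → P) × A) ℂ) := by
  rw [onProbe_eq_submatrix, Matrix.one_kronecker_one, Matrix.submatrix_one_equiv]

theorem conjTranspose_onProbe (ℓ : Fin m) (X : Matrix P P ℂ) :
    (onProbe ℓ X : Matrix ((Fin m → P) × A) ((Fin m → P) × A) ℂ)ᴴ = onProbe ℓ Xᴴ := by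
  simp only [onProbe_eq_submatrix, Matrix.conjTranspose_submatrix, Matrix.conjTranspose_kronecker,
    Matrix.conjTranspose_one]

variable [Fintype P] [Fintype A]

theorem onProbe_mul_onProbe (ℓ : Fin m) (X Y : Matrix P P ℂ) :
    (onProbe ℓ X * onProbe ℓ Y : Matrix ((Fin m → P) × A) ((Fin m → P) × A) ℂ)
      = onProbe ℓ (X * Y) := by
  simp only [onProbe_eq_submatrix, Matrix.submatrix_mul_equiv, ← Matrix.mul_kronecker_mul, one_mul]

theorem mul_onProbe_apply (ℓ : Fin m) (X : Matrix P P ℂ)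
    (M : Matrix ((Fin m → P) × A) ((Fin m → P) × A) ℂ) (x y : (Fin m → P) × A) :
    (M * onProbe ℓ X : Matrix ((Fin m → P) × A) ((Fin m → P) × A) ℂ) x y
      = ∑ c, M x (Function.update y.1 ℓ c, y.2) * X c (y.1 ℓ) := by
  have hupdate (c : P) : (probeSplit ℓ).symm (c, (probeSplit ℓ y).2)
      = (Function.update y.1 ℓ c, y.2) := by
    rw [Equiv.symm_apply_eq]
    ext j
    · simp [probeSplit]
    · simp [probeSplit, Function.update_of_ne j.2]
    · rfl
  rw [onProbe_eq_submatrix, Matrix.mul_apply, ← (probeSplit ℓ).symm.sum_comp,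
    Fintype.sum_prod_type]
  simp only [Matrix.submatrix_apply, Equiv.apply_symm_apply, Matrix.kroneckerMap_apply,
    Matrix.one_apply, mul_ite, mul_one, mul_zero, Finset.sum_ite_eq', Finset.mem_univ, if_true,
    hupdate]
  rfl

theorem trace_mul_onProbe_mul_onProbe {ℓ ℓ' : Fin m} (hne : ℓ ≠ ℓ') (X Y : Matrix P P ℂ)
    (M : Matrix ((Fin m → P) × A) ((Fin m → P) × A) ℂ) :
    (M * (onProbe ℓ X * onProbe ℓ' Y)).trace = (reduceTwo ℓ ℓ' M * X ⊗ₖ Y).trace := by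
  have hentry (x : (Fin m → P) × A) :
      (M * (onProbe ℓ X * onProbe ℓ' Y) : Matrix ((Fin m → P) × A) ((Fin m → P) × A) ℂ) x x
        = ∑ b : P × P, M x (Function.update (Function.update x.1 ℓ b.1) ℓ' b.2, x.2)
            * (X b.1 (x.1 ℓ) * Y b.2 (x.1 ℓ')) := by
    rw [← mul_assoc, mul_onProbe_apply, Fintype.sum_prod_type_right]
    simp only [mul_onProbe_apply, Finset.sum_mul, Function.update_of_ne hne, mul_assoc,
      Function.update_comm hne]
  have hreduced (a b : P × P) : reduceTwo ℓ ℓ' M a b * (X ⊗ₖ Y) b a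
      = ∑ x : (Fin m → P) × A, if (x.1 ℓ, x.1 ℓ') = a then
          M x (Function.update (Function.update x.1 ℓ b.1) ℓ' b.2, x.2)
            * (X b.1 a.1 * Y b.2 a.2) else 0 := by
    simp only [reduceTwo, Matrix.of_apply, Fintype.sum_prod_type, Finset.sum_mul, Prod.ext_iff,
      Matrix.kroneckerMap_apply, ite_mul, zero_mul]
  calc (M * (onProbe ℓ X * onProbe ℓ' Y)).trace
      = ∑ x : (Fin m → P) × A, ∑ b : P × P, ∑ a : P × P, if (x.1 ℓ, x.1 ℓ') = a then
          M x (Function.update (Function.update x.1 ℓ b.1) ℓ' b.2, x.2)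
            * (X b.1 a.1 * Y b.2 a.2) else 0 := by
        simp only [Matrix.trace, Matrix.diag_apply, hentry, Finset.sum_ite_eq, Finset.mem_univ,
          if_true]
    _ = (reduceTwo ℓ ℓ' M * X ⊗ₖ Y).trace := by
        simp only [Matrix.trace, Matrix.diag_apply, Matrix.mul_apply, hreduced]
        rw [Finset.sum_comm_cycle, Finset.sum_comm_cycle, Finset.sum_comm]

end OnProbe

section Recovery

variable {n κ : Type*} [Fintype n] [Fintype κ]

/-- The completely positive map `X ↦ ∑ j, K j X (K j)†` with Kraus operators `K j`. -/
def krausMap (K : κ → Matrix n n ℂ) : Matrix n n ℂ →ₗ[ℂ] Matrix n n ℂ where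
  toFun X := ∑ j, K j * X * (K j)ᴴ
  map_add' X Y := by simp only [mul_add, add_mul, Finset.sum_add_distrib]
  map_smul' c X := by
    simp only [Matrix.mul_smul, Matrix.smul_mul, RingHom.id_apply, Finset.smul_sum]

theorem krausMap_apply (K : κ → Matrix n n ℂ) (X : Matrix n n ℂ) :
    krausMap K X = ∑ j, K j * X * (K j)ᴴ :=
  rfl

theorem krausMap_unitary_mix [DecidableEq κ] {U : Matrix κ κ ℂ} (hU : U * Uᴴ = 1)
    (V : κ → Matrix n n ℂ) : krausMap (fun b => ∑ a, U a b • V a) = krausMap V := by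
  ext1 X
  calc ∑ b, (∑ a, U a b • V a) * X * (∑ a, U a b • V a)ᴴ
      = ∑ a, ∑ a', (U * Uᴴ) a a' • (V a * X * (V a')ᴴ) := by
        simp only [Matrix.conjTranspose_sum, Matrix.conjTranspose_smul, Finset.sum_mul,
          Finset.mul_sum, Matrix.smul_mul, Matrix.mul_smul, smul_smul, Matrix.mul_apply,
          Matrix.conjTranspose_apply, Finset.sum_smul]
        rw [Finset.sum_comm_cycle]
        exact Finset.sum_congr rfl fun a _ => Finset.sum_comm.trans <|
          Finset.sum_congr rfl fun a' _ => Finset.sum_congr rfl fun b _ => by rw [mul_comm]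
    _ = ∑ a, V a * X * (V a)ᴴ := by
        simp only [hU, Matrix.one_apply, ite_smul, one_smul, zero_smul, Finset.sum_ite_eq,
          Finset.mem_univ, if_true]

theorem conjTranspose_sum_smul_mul_sum_smul {T : Matrix n n ℂ} {V : κ → Matrix n n ℂ}
    {N : Matrix κ κ ℂ} (hV : ∀ a b, (V a)ᴴ * V b = N a b • T) (U : Matrix κ κ ℂ) (b c : κ) :
    (∑ a, U a b • V a)ᴴ * ∑ a, U a c • V a = (Uᴴ * N * U) b c • T := by
  simp only [Matrix.conjTranspose_sum, Matrix.conjTranspose_smul, Finset.sum_mul, Finset.mul_sum,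
    Matrix.smul_mul, Matrix.mul_smul, smul_smul, Matrix.mul_apply, Matrix.conjTranspose_apply,
    Finset.sum_smul, hV]
  exact Finset.sum_congr rfl fun a _ => Finset.sum_congr rfl fun a' _ => by rw [mul_comm]

theorem mul_eq_self_of_conjTranspose_mul_self {T X : Matrix n n ℂ} {c : ℂ}
    (hT : IsIdempotentElem T) (hX : Xᴴ * X = c • T) : X * T = X := by
  classical
  have hzero : (X * (1 - T))ᴴ * (X * (1 - T)) = 0 := by
    rw [Matrix.conjTranspose_mul, mul_assoc, ← mul_assoc Xᴴ, hX, Matrix.smul_mul,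
      hT.mul_one_sub_self, smul_zero, mul_zero]
  rw [Matrix.conjTranspose_mul_self_eq_zero, mul_sub, mul_one, sub_eq_zero] at hzero
  exact hzero.symm

variable {T : Matrix n n ℂ} {W : κ → Matrix n n ℂ}

theorem sum_mul_conjTranspose_mul_isometry [DecidableEq κ] (hT : IsIdempotentElem T)
    (hW : ∀ b c, (W b)ᴴ * W c = if b = c then T else 0) (c : κ) :
    (∑ b, W b * (W b)ᴴ) * W c = W c := by
  have hWT : W c * T = W c :=
    mul_eq_self_of_conjTranspose_mul_self (c := 1) hT (by simp [hW])
  simp [Finset.sum_mul, mul_assoc, hW, hWT]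

theorem isStarProjection_sum_mul_conjTranspose [DecidableEq κ] (hT : IsIdempotentElem T)
    (hW : ∀ b c, (W b)ᴴ * W c = if b = c then T else 0) :
    IsStarProjection (∑ b, W b * (W b)ᴴ) where
  isIdempotentElem := by
    rw [IsIdempotentElem, Finset.mul_sum]
    simp only [← mul_assoc, sum_mul_conjTranspose_mul_isometry hT hW]
  isSelfAdjoint := by
    rw [IsSelfAdjoint, Matrix.star_eq_conjTranspose, Matrix.conjTranspose_sum]
    simp only [Matrix.conjTranspose_mul, Matrix.conjTranspose_conjTranspose]

variable [DecidableEq n]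

theorem isChannel_krausMap {K : κ → Matrix n n ℂ} (hK : ∑ j, (K j)ᴴ * K j = 1) :
    IsChannel (krausMap K) := by
  let e := Fintype.equivFin κ
  refine ⟨Fintype.card κ, fun j => K (e.symm j), ?_, fun X => ?_⟩
  · rw [← hK]
    exact e.symm.sum_comp fun j => (K j)ᴴ * K j
  · exact (e.symm.sum_comp fun j => K j * X * (K j)ᴴ).symm

theorem sum_ketBra_single :
    ∑ x : n, ketBra (EuclideanSpace.single x 1) (EuclideanSpace.single x 1) = 1 := by
  ext i j
  simp [ketBra, Matrix.sum_apply, Matrix.one_apply, PiLp.single_apply, eq_comm]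

theorem sum_conjTranspose_mul_ketBra_single_mul {u : EuclideanSpace ℂ n} (hu : ‖u‖ = 1)
    (hT : IsStarProjection T) :
    ∑ x, (ketBra u (EuclideanSpace.single x 1) * T)ᴴ * (ketBra u (EuclideanSpace.single x 1) * T)
      = T := by
  have hterm (x : n) :
      (ketBra u (EuclideanSpace.single x 1) * T)ᴴ * (ketBra u (EuclideanSpace.single x 1) * T)
        = T * ketBra (EuclideanSpace.single x 1) (EuclideanSpace.single x 1) * T := by
    rw [Matrix.conjTranspose_mul, conjTranspose_ketBra, ← Matrix.star_eq_conjTranspose,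
      hT.isSelfAdjoint.star_eq, ← mul_assoc, mul_assoc T, ketBra_mul_ketBra,
      inner_self_eq_one_of_norm_eq_one hu, one_smul]
  simp only [hterm, ← Finset.sum_mul, ← Finset.mul_sum, sum_ketBra_single, mul_one,
    hT.isIdempotentElem.eq]

variable {ψ : Fin 2 → EuclideanSpace ℂ n}

theorem isRecovery_krausMap (hψ : Orthonormal ℂ ψ) {K : κ → Matrix n n ℂ}
    (hK : ∑ j, (K j)ᴴ * K j = 1) (hPK : ∀ j, codeProj ψ * K j = K j) :
    IsRecovery ψ (krausMap K) := by
  refine ⟨isChannel_krausMap hK, fun X => ?_⟩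
  have hKP (j : κ) : (K j)ᴴ * codeProj ψ = (K j)ᴴ := by
    simpa [← Matrix.star_eq_conjTranspose, (isStarProjection_codeProj hψ).isSelfAdjoint.star_eq]
      using congrArg star (hPK j)
  simp only [krausMap_apply, Finset.mul_sum, Finset.sum_mul, ← mul_assoc, hPK]
  simp only [mul_assoc, hKP]

/-- The recovery undoes each `W b`, and resets to `ψ 0` whatever lies outside their ranges. -/
theorem exists_isRecovery_of_isometries {ι : Type*} [Finite ι] [DecidableEq ι]
    (hψ : Orthonormal ℂ ψ) {W : ι → Matrix n n ℂ}
    (hW : ∀ b c, (W b)ᴴ * W c = if b = c then codeProj ψ else 0) :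
    ∃ R, IsRecovery ψ R ∧
      ∀ X, codeProj ψ * X * codeProj ψ = X → ∀ c, R (W c * X * (W c)ᴴ) = X := by
  have := Fintype.ofFinite ι
  have hP := isStarProjection_codeProj hψ
  have hS := isStarProjection_sum_mul_conjTranspose hP.isIdempotentElem hW
  have hSW := sum_mul_conjTranspose_mul_isometry hP.isIdempotentElem hW
  have hWP (b : ι) : W b * codeProj ψ = W b :=
    mul_eq_self_of_conjTranspose_mul_self (c := 1) hP.isIdempotentElem (by simp [hW])
  set S := ∑ b, W b * (W b)ᴴ with hSdef
  let K : ι ⊕ n → Matrix n n ℂ := Sum.elim (fun b => (W b)ᴴ)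
    (fun x => ketBra (ψ 0) (EuclideanSpace.single x 1) * (1 - S))
  have hK : ∑ j, (K j)ᴴ * K j = 1 := by
    simp only [K, Fintype.sum_sum_type, Sum.elim_inl, Sum.elim_inr,
      Matrix.conjTranspose_conjTranspose, ← hSdef,
      sum_conjTranspose_mul_ketBra_single_mul (hψ.1 0) hS.one_sub, add_sub_cancel]
  have hPK : ∀ j, codeProj ψ * K j = K j := by
    rintro (b | x)
    · change codeProj ψ * star (W b) = star (W b)
      simpa [hP.isSelfAdjoint.star_eq] using congrArg star (hWP b)
    · simp only [K, Sum.elim_inr, ← mul_assoc, codeProj_mul_ketBra hψ]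
  refine ⟨krausMap K, isRecovery_krausMap hψ hK hPK, fun X hX c => ?_⟩
  have hcorrect (b : ι) : (W b)ᴴ * (W c * X * (W c)ᴴ) * W b = if b = c then X else 0 := by
    have hassoc : (W b)ᴴ * (W c * X * (W c)ᴴ) * W b = (W b)ᴴ * W c * X * ((W c)ᴴ * W b) := by
      simp only [mul_assoc]
    rw [hassoc, hW, hW]
    rcases eq_or_ne b c with rfl | hbc
    · simp [hX]
    · simp [hbc]
  have hreset (x : n) : K (Sum.inr x) * (W c * X * (W c)ᴴ) = 0 := by
    simp only [K, Sum.elim_inr, ← mul_assoc]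
    simp only [mul_assoc _ (1 - S), sub_mul, one_mul, hSW, sub_self, mul_zero, zero_mul]
  rw [krausMap_apply, Fintype.sum_sum_type]
  simp only [hreset, zero_mul, Finset.sum_const_zero, add_zero, K, Sum.elim_inl,
    Matrix.conjTranspose_conjTranspose, hcorrect, Finset.sum_ite_eq', Finset.mem_univ, if_true]

theorem exists_isRecovery_of_orthogonal {ι : Type*} [Finite ι] [DecidableEq ι]
    (hψ : Orthonormal ℂ ψ) {F : ι → Matrix n n ℂ} {d : ι → ℝ}
    (hF : ∀ b c, (F b)ᴴ * F c = (if b = c then (d b : ℂ) else 0) • codeProj ψ) :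
    ∃ R, IsRecovery ψ R ∧
      ∀ X, codeProj ψ * X * codeProj ψ = X → ∀ c, R (F c * X * (F c)ᴴ) = (d c : ℂ) • X := by
  have hd (b : ι) : 0 ≤ d b := by
    have htrace := (Matrix.posSemidef_conjTranspose_mul_self (F b)).trace_nonneg
    rw [hF, if_pos rfl, Matrix.trace_smul, trace_codeProj hψ, smul_eq_mul] at htrace
    have htrace' : (0 : ℂ) ≤ ((d b * 2 : ℝ) : ℂ) := by exact_mod_cast htrace
    linarith [Complex.zero_le_real.1 htrace']
  have hsq (b : ι) : (√(d b) : ℂ) * √(d b) = d b := by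
    rw [← Complex.ofReal_mul, Real.mul_self_sqrt (hd b)]
  let W : {b // d b ≠ 0} → Matrix n n ℂ := fun b => (√(d b) : ℂ)⁻¹ • F b
  have hW (b c : {b // d b ≠ 0}) : (W b)ᴴ * W c = if b = c then codeProj ψ else 0 := by
    rcases eq_or_ne b c with rfl | hbc
    · have hscale : (√(d b) : ℂ)⁻¹ * ((√(d b) : ℂ)⁻¹ * d b) = 1 := by
        rw [← mul_assoc, ← mul_inv, hsq, inv_mul_cancel₀ (Complex.ofReal_ne_zero.2 b.2)]
      simp only [W, Matrix.conjTranspose_smul, Matrix.smul_mul, Matrix.mul_smul, hF, if_true,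
        star_inv₀, RCLike.star_def, Complex.conj_ofReal, smul_smul, hscale, one_smul]
    · simp [W, hF, hbc, Subtype.coe_inj]
  obtain ⟨R, hR, hRW⟩ := exists_isRecovery_of_isometries hψ hW
  refine ⟨R, hR, fun X hX c => ?_⟩
  rcases eq_or_ne (d c) 0 with hc | hc
  · have hFc : F c = 0 := by
      rw [← Matrix.conjTranspose_mul_self_eq_zero, hF, if_pos rfl, hc, Complex.ofReal_zero,
        zero_smul]
    rw [hFc, hc]
    simp
  · have hFW : F c * X * (F c)ᴴ = (d c : ℂ) • (W ⟨c, hc⟩ * X * (W ⟨c, hc⟩)ᴴ) := by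
      have hscale : (d c : ℂ) * ((√(d c) : ℂ)⁻¹ * (√(d c) : ℂ)⁻¹) = 1 := by
        rw [← mul_inv, hsq, mul_inv_cancel₀ (Complex.ofReal_ne_zero.2 hc)]
      simp [W, smul_smul, hscale]
    rw [hFW, map_smul, hRW X hX]

theorem exists_isRecovery_of_knillLaflamme (hψ : Orthonormal ℂ ψ)
    {V : κ → Matrix n n ℂ} {N : Matrix κ κ ℂ} (hV : ∀ a b, (V a)ᴴ * V b = N a b • codeProj ψ) :
    ∃ R, IsRecovery ψ R ∧
      ∀ X, codeProj ψ * X * codeProj ψ = X → R (krausMap V X) = N.trace • X := by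
  classical
  have hN : N.IsHermitian := by
    ext a b
    have hstar : star (N b a • codeProj ψ) = N a b • codeProj ψ := by
      rw [← hV, ← hV, Matrix.star_eq_conjTranspose, Matrix.conjTranspose_mul,
        Matrix.conjTranspose_conjTranspose]
    simpa [(isStarProjection_codeProj hψ).isSelfAdjoint.star_eq, Matrix.trace_smul,
      trace_codeProj hψ] using congrArg Matrix.trace hstar
  set U : Matrix κ κ ℂ := (hN.eigenvectorUnitary : Matrix κ κ ℂ)
  have hU : U * Uᴴ = 1 := Unitary.coe_mul_star_self hN.eigenvectorUnitary
  have hdiag : Uᴴ * N * U = Matrix.diagonal fun a => (hN.eigenvalues a : ℂ) := by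
    have := hN.conjStarAlgAut_star_eigenvectorUnitary
    rwa [Unitary.conjStarAlgAut_star_apply] at this
  obtain ⟨R, hR, hRF⟩ := exists_isRecovery_of_orthogonal hψ fun b c =>
    (conjTranspose_sum_smul_mul_sum_smul hV U b c).trans (by rw [hdiag, Matrix.diagonal_apply])
  refine ⟨R, hR, fun X hX => ?_⟩
  rw [← krausMap_unitary_mix hU V, krausMap_apply, map_sum]
  simp only [hRF X hX, ← Finset.sum_smul, hN.trace_eq_sum_eigenvalues]
  rfl

end Recovery

section Lindbladian

variable {n κ : Type*} [Fintype n]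

/-- The contribution `J X J† - ½ {J† J, X}` of the jump operator `J` to the master equation. -/
noncomputable def dissipator (J X : Matrix n n ℂ) : Matrix n n ℂ :=
  J * X * Jᴴ - (1 / 2 : ℂ) • (Jᴴ * J * X + X * (Jᴴ * J))

theorem lindbladian_apply [Fintype κ] (G : Matrix n n ℂ) (J : κ → Matrix n n ℂ)
    (X : Matrix n n ℂ) :
    lindbladian G J X = (-Complex.I) • comm G X + ∑ k, dissipator (J k) X :=
  rfl

/-- The right-hand side of the noiseless master equation with Hamiltonian `G`. -/
noncomputable def hamiltonianGenerator (G : Matrix n n ℂ) : Matrix n n ℂ →ₗ[ℂ] Matrix n n ℂ :=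
  lindbladian G (0 : Fin 0 → Matrix n n ℂ)

theorem hamiltonianGenerator_apply (G X : Matrix n n ℂ) :
    hamiltonianGenerator G X = (-Complex.I) • comm G X := by
  rw [hamiltonianGenerator, lindbladian_apply, Finset.univ_eq_empty, Finset.sum_empty, add_zero]

/-- An operator whose compression to the code space is a multiple of the projection: the
Knill–Laflamme condition. -/
def IsScalarOnCode (ψ : Fin 2 → EuclideanSpace ℂ n) (X : Matrix n n ℂ) : Prop :=
  ∃ c : ℂ, codeProj ψ * X * codeProj ψ = c • codeProj ψ

theorem isScalarOnCode_of_trace_eq {ψ : Fin 2 → EuclideanSpace ℂ n}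
    {X : Matrix n n ℂ} {f : Fin 2 → ℂ} (hf : f 0 = f 1)
    (hX : ∀ k k', (ketBra (ψ k) (ψ k') * X).trace = if k = k' then f k else 0) :
    IsScalarOnCode ψ X :=
  ⟨(f 0 + f 1) / 2, by rw [codeProj_mul_mul_codeProj hX, hf, sub_self, zero_div, zero_smul,
    add_zero]⟩

variable {T X : Matrix n n ℂ}

theorem mul_eq_self_and_mul_eq_self (hT : IsIdempotentElem T) (hX : T * X * T = X) :
    T * X = X ∧ X * T = X :=
  (Subsemigroup.mem_corner_iff hT).1 ⟨X, hX⟩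

theorem compress_comm (hT : IsIdempotentElem T) (hX : T * X * T = X) (G : Matrix n n ℂ) :
    T * comm G X * T = comm (T * G * T) X := by
  obtain ⟨hTX, hXT⟩ := mul_eq_self_and_mul_eq_self hT hX
  calc T * comm G X * T = T * G * (X * T) - T * X * G * T := by
        simp only [comm, mul_sub, sub_mul, mul_assoc]
    _ = T * G * (T * X) - X * T * G * T := by rw [hTX, hXT]
    _ = comm (T * G * T) X := by simp only [comm, mul_assoc]

theorem comm_smul_add (hT : IsIdempotentElem T) (hX : T * X * T = X) (c : ℂ) (G : Matrix n n ℂ) :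
    comm (c • T + G) X = comm G X := by
  obtain ⟨hTX, hXT⟩ := mul_eq_self_and_mul_eq_self hT hX
  simp only [comm, add_mul, mul_add, Matrix.smul_mul, Matrix.mul_smul, hTX, hXT,
    add_sub_add_left_eq_sub]

theorem compress_conjTranspose {c : ℂ} {J : Matrix n n ℂ} (hT : IsStarProjection T)
    (hJ : T * J * T = c • T) : T * Jᴴ * T = star c • T := by
  have hTs : Tᴴ = T := hT.isSelfAdjoint
  simpa [hTs, mul_assoc] using congrArg Matrix.conjTranspose hJ

theorem compress_dissipator {c μ : ℂ} {J : Matrix n n ℂ} (hT : IsStarProjection T)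
    (hJ : T * J * T = c • T) (hJJ : T * (Jᴴ * J) * T = μ • T) (hX : T * X * T = X) :
    T * dissipator J X * T = (c * star c - μ) • X := by
  obtain ⟨hTX, -⟩ := mul_eq_self_and_mul_eq_self hT.isIdempotentElem hX
  have hjump : T * (J * X * Jᴴ) * T = (c * star c) • X :=
    calc T * (J * X * Jᴴ) * T = T * J * (T * X * T) * Jᴴ * T := by simp only [hX, mul_assoc]
      _ = T * J * T * X * (T * Jᴴ * T) := by simp only [mul_assoc]
      _ = (c * star c) • X := by
        rw [hJ, compress_conjTranspose hT hJ, Matrix.smul_mul, Matrix.smul_mul, Matrix.mul_smul,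
          hX, smul_smul]
  have hleft : T * (Jᴴ * J * X) * T = μ • X :=
    calc T * (Jᴴ * J * X) * T = T * (Jᴴ * J) * T * X * T := by
          rw [mul_assoc _ T X, hTX, ← mul_assoc T]
      _ = μ • X := by rw [hJJ, Matrix.smul_mul, Matrix.smul_mul, hX]
  have hright : T * (X * (Jᴴ * J)) * T = μ • X :=
    calc T * (X * (Jᴴ * J)) * T = T * X * (T * (Jᴴ * J) * T) := by
          rw [mul_assoc T (Jᴴ * J), ← mul_assoc (T * X) T, hX, ← mul_assoc T X, hTX, mul_assoc]
      _ = μ • X := by rw [hJJ, Matrix.mul_smul, hX]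
  rw [dissipator, mul_sub, sub_mul, Matrix.mul_smul, Matrix.smul_mul, mul_add, add_mul, hjump,
    hleft, hright]
  module

variable [DecidableEq n]

theorem one_sub_mul_eq_zero_and_mul_one_sub_eq_zero (hT : IsIdempotentElem T)
    (hX : T * X * T = X) : (1 - T) * X = 0 ∧ X * (1 - T) = 0 := by
  obtain ⟨hTX, hXT⟩ := mul_eq_self_and_mul_eq_self hT hX
  simp [sub_mul, mul_sub, hTX, hXT]

/-- The part `T_⊥ J T` of the operator `J` that leads out of the range of the projection `T`. -/
def leakage (T J : Matrix n n ℂ) : Matrix n n ℂ := (1 - T) * J * T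

theorem conjTranspose_leakage (hT : IsStarProjection T) (J : Matrix n n ℂ) :
    (leakage T J)ᴴ = T * Jᴴ * (1 - T) := by
  have hTs : Tᴴ = T := hT.isSelfAdjoint
  simp [leakage, hTs, mul_assoc]

theorem conjTranspose_leakage_mul_leakage {c c' μ : ℂ} {J J' : Matrix n n ℂ}
    (hT : IsStarProjection T) (hJ : T * J * T = c • T) (hJ' : T * J' * T = c' • T)
    (hJJ' : T * (Jᴴ * J') * T = μ • T) :
    (leakage T J)ᴴ * leakage T J' = (μ - star c * c') • T :=
  calc (leakage T J)ᴴ * leakage T J' = T * Jᴴ * ((1 - T) * (1 - T)) * J' * T := by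
        rw [conjTranspose_leakage hT, leakage]
        simp only [mul_assoc]
    _ = T * (Jᴴ * J') * T - T * Jᴴ * (T * J' * T) := by
        rw [hT.isIdempotentElem.one_sub.eq]
        simp only [mul_sub, sub_mul, mul_one, mul_assoc]
    _ = T * (Jᴴ * J') * T - T * Jᴴ * T * (c' • 1) := by
        rw [hJ', Matrix.mul_smul, Matrix.mul_smul, mul_one]
    _ = (μ - star c * c') • T := by
        rw [hJJ', compress_conjTranspose hT hJ, Matrix.mul_smul, mul_one, smul_smul, sub_smul,
          mul_comm c']

theorem compress_compl_comm (hT : IsIdempotentElem T) (hX : T * X * T = X)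
    (G : Matrix n n ℂ) : (1 - T) * comm G X * (1 - T) = 0 := by
  obtain ⟨hTX, hXT⟩ := one_sub_mul_eq_zero_and_mul_one_sub_eq_zero hT hX
  calc (1 - T) * comm G X * (1 - T)
      = (1 - T) * G * (X * (1 - T)) - (1 - T) * X * G * (1 - T) := by
        rw [comm, mul_sub (1 - T), sub_mul _ _ (1 - T)]
        simp only [mul_assoc]
    _ = 0 := by simp only [hTX, hXT, mul_zero, zero_mul, sub_self]

theorem compress_compl_dissipator (hT : IsStarProjection T) (hX : T * X * T = X)
    (J : Matrix n n ℂ) :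
    (1 - T) * dissipator J X * (1 - T) = leakage T J * X * (leakage T J)ᴴ := by
  obtain ⟨hTX, hXT⟩ := one_sub_mul_eq_zero_and_mul_one_sub_eq_zero hT.isIdempotentElem hX
  calc (1 - T) * dissipator J X * (1 - T)
      = (1 - T) * J * X * Jᴴ * (1 - T) - (1 / 2 : ℂ) •
          ((1 - T) * Jᴴ * J * (X * (1 - T)) + (1 - T) * X * Jᴴ * J * (1 - T)) := by
        rw [dissipator, mul_sub (1 - T), sub_mul _ _ (1 - T), Matrix.mul_smul, Matrix.smul_mul,
          mul_add (1 - T), add_mul _ _ (1 - T)]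
        simp only [mul_assoc]
    _ = (1 - T) * J * (T * X * T) * Jᴴ * (1 - T) := by
        simp only [hTX, hXT, hX, mul_zero, zero_mul, add_zero, smul_zero, sub_zero]
    _ = leakage T J * X * (leakage T J)ᴴ := by
        rw [conjTranspose_leakage hT, leakage]
        simp only [mul_assoc]

variable {ψ : Fin 2 → EuclideanSpace ℂ n}

theorem exists_isRecovery_lindbladian [Fintype κ] (hψ : Orthonormal ℂ ψ) {J : κ → Matrix n n ℂ}
    (hJ : ∀ a, IsScalarOnCode ψ (J a)) (hJJ : ∀ a b, IsScalarOnCode ψ ((J a)ᴴ * J b)) :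
    ∃ R, IsRecovery ψ R ∧ ∀ G X, codeProj ψ * X * codeProj ψ = X →
      qecOperation ψ R (lindbladian G J X)
        = (-Complex.I) • comm (codeProj ψ * G * codeProj ψ) X := by
  choose c hc using hJ
  choose μ hμ using hJJ
  have hP := isStarProjection_codeProj hψ
  obtain ⟨R, hR, hRV⟩ := exists_isRecovery_of_knillLaflamme hψ
    (N := Matrix.of fun a b => μ a b - star (c a) * c b)
    fun a b => conjTranspose_leakage_mul_leakage hP (hc a) (hc b) (hμ a b)
  refine ⟨R, hR, fun G X hX => ?_⟩
  have hin : codeProj ψ * lindbladian G J X * codeProj ψ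
      = (-Complex.I) • comm (codeProj ψ * G * codeProj ψ) X
        + (∑ a, (c a * star (c a) - μ a a)) • X := by
    rw [lindbladian_apply, mul_add, add_mul, Matrix.mul_smul, Matrix.smul_mul,
      compress_comm hP.isIdempotentElem hX, Finset.mul_sum, Finset.sum_mul, Finset.sum_smul]
    simp only [compress_dissipator hP (hc _) (hμ _ _) hX]
  have hout : (1 - codeProj ψ) * lindbladian G J X * (1 - codeProj ψ)
      = krausMap (fun a => leakage (codeProj ψ) (J a)) X := by
    rw [lindbladian_apply, mul_add (1 - codeProj ψ), add_mul _ _ (1 - codeProj ψ),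
      Matrix.mul_smul, Matrix.smul_mul, compress_compl_comm hP.isIdempotentElem hX,
      smul_zero, zero_add, Finset.mul_sum, Finset.sum_mul, krausMap_apply]
    simp only [compress_compl_dissipator hP hX]
  have hcancel : ∑ a, (c a * star (c a) - μ a a)
      + (Matrix.of fun a b => μ a b - star (c a) * c b).trace = 0 := by
    simp [Matrix.trace, mul_comm]
  rw [qecOperation, hin, hout, hRV X hX, add_assoc, ← add_smul, hcancel, zero_smul, add_zero]

end Lindbladian

section CodeZeno

variable {n : Type*} [Fintype n] [DecidableEq n]

theorem norm_le_re_trace_of_posSemidef {X : Matrix n n ℂ} (hX : X.PosSemidef) :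
    ‖X‖ ≤ X.trace.re := by
  have hH := hX.isHermitian
  have hnorm : ‖X‖ = ‖fun i => (hH.eigenvalues i : ℂ)‖ := by
    conv_lhs => rw [hH.spectral_theorem, Unitary.conjStarAlgAut_apply, ← Unitary.coe_star,
      CStarRing.norm_mul_coe_unitary, CStarRing.norm_coe_unitary_mul, Matrix.l2_opNorm_diagonal]
    rfl
  have htrace : X.trace.re = ∑ i, hH.eigenvalues i := by
    rw [hH.trace_eq_sum_eigenvalues, Complex.re_sum]
    rfl
  rw [hnorm, htrace,
    pi_norm_le_iff_of_nonneg (Finset.sum_nonneg fun i _ => hX.eigenvalues_nonneg i)]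
  intro i
  rw [Complex.norm_real, Real.norm_of_nonneg (hX.eigenvalues_nonneg i)]
  exact Finset.single_le_sum (fun j _ => hX.eigenvalues_nonneg j) (Finset.mem_univ i)

theorem IsDensity.norm_le_one {σ : Matrix n n ℂ} (hσ : IsDensity σ) : ‖σ‖ ≤ 1 := by
  simpa [hσ.2] using norm_le_re_trace_of_posSemidef hσ.1

variable {ψ : Fin 2 → EuclideanSpace ℂ n}

/-- The QEC operation as a linear map. -/
noncomputable def qecLinear (ψ : Fin 2 → EuclideanSpace ℂ n)
    (R : Matrix n n ℂ →ₗ[ℂ] Matrix n n ℂ) : Matrix n n ℂ →ₗ[ℂ] Matrix n n ℂ where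
  toFun := qecOperation ψ R
  map_add' X Y := by
    simp only [qecOperation, mul_add, add_mul, map_add]
    abel
  map_smul' c X := by
    simp only [qecOperation, Matrix.mul_smul, Matrix.smul_mul, map_smul, RingHom.id_apply,
      smul_add]

/-- The compression `X ↦ P X P` to the code space, as a linear map. -/
noncomputable def codeCompression (ψ : Fin 2 → EuclideanSpace ℂ n) :
    Matrix n n ℂ →ₗ[ℂ] Matrix n n ℂ where
  toFun X := codeProj ψ * X * codeProj ψ
  map_add' X Y := by simp only [mul_add, add_mul]
  map_smul' c X := by simp only [Matrix.mul_smul, Matrix.smul_mul, RingHom.id_apply]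

theorem codeProj_mul_codeCompression_mul_codeProj (hψ : Orthonormal ℂ ψ) (X : Matrix n n ℂ) :
    codeProj ψ * codeCompression ψ X * codeProj ψ = codeCompression ψ X := by
  have hPP := (isStarProjection_codeProj hψ).isIdempotentElem.eq
  calc codeProj ψ * (codeProj ψ * X * codeProj ψ) * codeProj ψ
      = (codeProj ψ * codeProj ψ) * X * (codeProj ψ * codeProj ψ) := by simp only [mul_assoc]
    _ = codeProj ψ * X * codeProj ψ := by rw [hPP]

theorem qecOperation_eq_self (hψ : Orthonormal ℂ ψ) (R : Matrix n n ℂ →ₗ[ℂ] Matrix n n ℂ)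
    {X : Matrix n n ℂ} (hX : codeProj ψ * X * codeProj ψ = X) : qecOperation ψ R X = X := by
  obtain ⟨hPX, -⟩ := one_sub_mul_eq_zero_and_mul_one_sub_eq_zero
    (isStarProjection_codeProj hψ).isIdempotentElem hX
  rw [qecOperation, hX, hPX, zero_mul, map_zero, add_zero]

theorem IsRecovery.codeCompression_qecOperation {R : Matrix n n ℂ →ₗ[ℂ] Matrix n n ℂ}
    (hψ : Orthonormal ℂ ψ) (hR : IsRecovery ψ R) (X : Matrix n n ℂ) :
    codeCompression ψ (qecOperation ψ R X) = qecOperation ψ R X := by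
  rw [qecOperation, map_add]
  exact congrArg₂ _ (codeProj_mul_codeCompression_mul_codeProj hψ X) (hR.2 _)

theorem qecState_eq_pow_apply (R 𝓛 : Matrix n n ℂ →ₗ[ℂ] Matrix n n ℂ) (τ : ℝ) (N : ℕ)
    (σ : Matrix n n ℂ) :
    qecState ψ R 𝓛 τ N σ = ((toCLM (qecLinear ψ R) * evolve 𝓛 τ) ^ N) σ :=
  (pow_apply_eq_iterate (toCLM (qecLinear ψ R) * evolve 𝓛 τ) N σ).symm

theorem exists_norm_qecState_sub_evolve_le (hψ : Orthonormal ℂ ψ)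
    {R 𝓛 𝓓 : Matrix n n ℂ →ₗ[ℂ] Matrix n n ℂ} (hR : IsRecovery ψ R)
    (h𝓓 : ∀ X, codeProj ψ * X * codeProj ψ = X → qecOperation ψ R (𝓛 X) = 𝓓 X)
    (T : ℝ) {ε : ℝ} (hε : 0 < ε) :
    ∃ δ > 0, ∀ σ : Matrix n n ℂ, IsLogicalState ψ σ →
      ∀ (τ : ℝ) (N : ℕ), 0 < τ → τ ≤ δ → N * τ ≤ T →
        ‖qecState ψ R 𝓛 τ N σ - evolve 𝓓 (N * τ) σ‖ ≤ ε := by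
  have : Nonempty n := by
    by_contra hn
    rw [not_nonempty_iff] at hn
    exact hψ.ne_zero 0 (Subsingleton.elim _ _)
  have hcompress := codeProj_mul_codeCompression_mul_codeProj hψ
  obtain ⟨δ, hδ, h⟩ := exists_norm_pow_mul_exp_smul_sub_exp_smul_mul_le
    (a := toCLM 𝓛) (c := toCLM (qecLinear ψ R)) (d := toCLM 𝓓) (q := toCLM (codeCompression ψ))
    (ContinuousLinearMap.ext hcompress)
    (ContinuousLinearMap.ext fun X => qecOperation_eq_self hψ R (hcompress X))
    (ContinuousLinearMap.ext (hR.codeCompression_qecOperation hψ))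
    (ContinuousLinearMap.ext fun X => h𝓓 _ (hcompress X)) T hε
  refine ⟨δ, hδ, fun σ ⟨hσ, hPσ⟩ τ N hτ hτδ hN => ?_⟩
  have hσq : toCLM (codeCompression ψ) σ = σ := hPσ
  calc ‖qecState ψ R 𝓛 τ N σ - evolve 𝓓 (N * τ) σ‖
      = ‖(((toCLM (qecLinear ψ R) * evolve 𝓛 τ) ^ N - evolve 𝓓 (N * τ))
          * toCLM (codeCompression ψ)) σ‖ := by
        rw [qecState_eq_pow_apply, mul_apply_eq_comp, hσq, sub_apply]
    _ ≤ ε * 1 := ContinuousLinearMap.le_of_opNorm_le_of_le _ (h τ N hτ hτδ hN) hσ.norm_le_one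
    _ = ε := mul_one ε

end CodeZeno

section CodeConditions

variable {P A : Type*} [Fintype P] {r m : ℕ}

/-- The complex linear span of `1, L i, (L i)†, (L i)† L j`, of which the Lindblad span consists
of the Hermitian elements. -/
def complexLindbladSpan [DecidableEq P] (L : Fin r → Matrix P P ℂ) : Submodule ℂ (Matrix P P ℂ) :=
  Submodule.span ℂ ({1} ∪ Set.range L ∪ Set.range (fun i => (L i)ᴴ)
    ∪ Set.range (fun ij : Fin r × Fin r => (L ij.1)ᴴ * L ij.2))

theorem mul_mem_complexLindbladSpan [DecidableEq P] (L : Fin r → Matrix P P ℂ) (i j : Fin r) :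
    (L i)ᴴ * L j ∈ complexLindbladSpan L :=
  Submodule.subset_span (Or.inr ⟨(i, j), rfl⟩)

theorem mem_complexLindbladSpan [DecidableEq P] (L : Fin r → Matrix P P ℂ) (i : Fin r) :
    L i ∈ complexLindbladSpan L :=
  Submodule.subset_span (by simp)

theorem conjTranspose_mem_complexLindbladSpan [DecidableEq P] {L : Fin r → Matrix P P ℂ}
    {X : Matrix P P ℂ} (hX : X ∈ complexLindbladSpan L) : Xᴴ ∈ complexLindbladSpan L := by
  induction hX using Submodule.span_induction with
  | zero => simp
  | add X Y _ _ hX hY => simpa using add_mem hX hY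
  | smul c X _ hX => simpa using Submodule.smul_mem _ (star c) hX
  | mem X hX =>
    rcases hX with ((rfl | ⟨i, rfl⟩) | ⟨i, rfl⟩) | ⟨⟨i, j⟩, rfl⟩
    · exact Submodule.subset_span (by simp)
    · exact Submodule.subset_span (by simp)
    · simpa using mem_complexLindbladSpan L i
    · simpa using mul_mem_complexLindbladSpan L j i

theorem trace_mul_eq_zero_of_mem_complexLindbladSpan [DecidableEq P] {L : Fin r → Matrix P P ℂ}
    {D X : Matrix P P ℂ} (hD : ∀ S ∈ lindbladSpan L, (D * S).trace = 0)
    (hX : X ∈ complexLindbladSpan L) : (D * X).trace = 0 := by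
  have hre : (realPart X : Matrix P P ℂ) ∈ lindbladSpan L :=
    ⟨by
      rw [realPart_apply_coe]
      exact Submodule.smul_of_tower_mem _ _
        (add_mem hX (conjTranspose_mem_complexLindbladSpan hX)), (realPart X).2⟩
  have him : (imaginaryPart X : Matrix P P ℂ) ∈ lindbladSpan L :=
    ⟨by
      rw [imaginaryPart_apply_coe]
      exact Submodule.smul_mem _ _ (Submodule.smul_of_tower_mem _ _
        (sub_mem hX (conjTranspose_mem_complexLindbladSpan hX))), (imaginaryPart X).2⟩
  rw [← realPart_add_I_smul_imaginaryPart X, mul_add, Matrix.mul_smul, Matrix.trace_add,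
    Matrix.trace_smul, hD _ hre, hD _ him, smul_zero, add_zero]

variable [DecidableEq P] [Fintype A] [DecidableEq A] {ρ Q : Fin 2 → Matrix P P ℂ}
  {ψ : Fin 2 → EuclideanSpace ℂ ((Fin m → P) × A)}

/-- The two-probe marginals of the code prescribed in the paper: `ρ k ⊗ ρ k - Q k ⊗ Q k` for
`|k⟩⟨k|`, and `0` for the coherences. -/
def HasTwoProbeMarginals (ψ : Fin 2 → EuclideanSpace ℂ ((Fin m → P) × A))
    (ρ Q : Fin 2 → Matrix P P ℂ) : Prop :=
  ∀ (k k' : Fin 2) (ℓ ℓ' : Fin m), ℓ ≠ ℓ' →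
    reduceTwo ℓ ℓ' (ketBra (ψ k) (ψ k')) = if k = k' then ρ k ⊗ₖ ρ k - Q k ⊗ₖ Q k else 0

namespace HasTwoProbeMarginals

theorem trace_mul_onProbe_mul_onProbe (hcode : HasTwoProbeMarginals ψ ρ Q) {ℓ ℓ' : Fin m}
    (hne : ℓ ≠ ℓ') (X Y : Matrix P P ℂ) (k k' : Fin 2) :
    (ketBra (ψ k) (ψ k') * (onProbe ℓ X * onProbe ℓ' Y)).trace = if k = k' then
      (ρ k * X).trace * (ρ k * Y).trace - (Q k * X).trace * (Q k * Y).trace else 0 := by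
  rw [MultiProbe.trace_mul_onProbe_mul_onProbe hne, hcode k k' ℓ ℓ' hne]
  split_ifs
  · rw [sub_mul, Matrix.trace_sub, ← Matrix.mul_kronecker_mul, ← Matrix.mul_kronecker_mul,
      Matrix.trace_kronecker, Matrix.trace_kronecker]
  · rw [zero_mul, Matrix.trace_zero]

theorem trace_mul_onProbe (hcode : HasTwoProbeMarginals ψ ρ Q) (hm : 2 ≤ m)
    (hρ : ∀ k, (ρ k).trace = 1) (hQ : ∀ k, (Q k).trace = 0) (ℓ : Fin m) (X : Matrix P P ℂ)
    (k k' : Fin 2) :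
    (ketBra (ψ k) (ψ k') * onProbe ℓ X).trace = if k = k' then (ρ k * X).trace else 0 := by
  have : Nontrivial (Fin m) := Fin.nontrivial_iff_two_le.2 hm
  obtain ⟨ℓ', hne⟩ := exists_ne ℓ
  simpa only [onProbe_one, mul_one, hρ, hQ, mul_zero, sub_zero] using
    hcode.trace_mul_onProbe_mul_onProbe hne.symm X 1 k k'

theorem isScalarOnCode_onProbe (hcode : HasTwoProbeMarginals ψ ρ Q) (hm : 2 ≤ m)
    (hρ : ∀ k, (ρ k).trace = 1) (hQ : ∀ k, (Q k).trace = 0) {X : Matrix P P ℂ}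
    (hX : (ρ 0 * X).trace = (ρ 1 * X).trace) (ℓ : Fin m) :
    IsScalarOnCode ψ (onProbe ℓ X) :=
  isScalarOnCode_of_trace_eq (f := fun k => (ρ k * X).trace) hX
    (hcode.trace_mul_onProbe hm hρ hQ ℓ X)

theorem isScalarOnCode_onProbe_mul_onProbe (hcode : HasTwoProbeMarginals ψ ρ Q)
    {X Y : Matrix P P ℂ} (hX : (ρ 0 * X).trace = (ρ 1 * X).trace)
    (hY : (ρ 0 * Y).trace = (ρ 1 * Y).trace) (hQY : ∀ k, (Q k * Y).trace = 0)
    {ℓ ℓ' : Fin m} (hne : ℓ ≠ ℓ') :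
    IsScalarOnCode ψ (onProbe ℓ X * onProbe ℓ' Y) :=
  isScalarOnCode_of_trace_eq (f := fun k => (ρ k * X).trace * (ρ k * Y).trace)
    (congrArg₂ _ hX hY) fun k k' => by
      rw [hcode.trace_mul_onProbe_mul_onProbe hne, hQY, mul_zero, sub_zero]

theorem codeProj_mul_sum_onProbe_mul_codeProj (hcode : HasTwoProbeMarginals ψ ρ Q) (hm : 2 ≤ m)
    (hρ : ∀ k, (ρ k).trace = 1) (hQ : ∀ k, (Q k).trace = 0) (X : Matrix P P ℂ) :
    codeProj ψ * (∑ ℓ, onProbe ℓ X) * codeProj ψ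
      = (m * ((ρ 0 + ρ 1) * X).trace / 2) • codeProj ψ
        + (m * ((ρ 0 - ρ 1) * X).trace / 2) • logicalZ ψ := by
  rw [Finset.mul_sum, Finset.sum_mul]
  simp only [codeProj_mul_mul_codeProj (hcode.trace_mul_onProbe hm hρ hQ _ X), Finset.sum_const,
    Finset.card_univ, Fintype.card_fin, add_mul, sub_mul, Matrix.trace_add, Matrix.trace_sub,
    ← Nat.cast_smul_eq_nsmul ℂ]
  module

theorem isScalarOnCode_conjTranspose_onProbe_mul_onProbe (hcode : HasTwoProbeMarginals ψ ρ Q)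
    (hm : 2 ≤ m) (hρ : ∀ k, (ρ k).trace = 1) (hQ : ∀ k, (Q k).trace = 0)
    {L : Fin r → Matrix P P ℂ} (hQL : ∀ k i, (Q k * L i).trace = 0)
    (hspan : ∀ X ∈ complexLindbladSpan L, (ρ 0 * X).trace = (ρ 1 * X).trace)
    (i j : Fin r) (ℓ ℓ' : Fin m) :
    IsScalarOnCode ψ ((onProbe ℓ (L i))ᴴ * onProbe ℓ' (L j)) := by
  rw [conjTranspose_onProbe]
  obtain rfl | hne := eq_or_ne ℓ ℓ'
  · rw [onProbe_mul_onProbe]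
    exact hcode.isScalarOnCode_onProbe hm hρ hQ (hspan _ (mul_mem_complexLindbladSpan L i j)) ℓ
  · exact hcode.isScalarOnCode_onProbe_mul_onProbe
      (hspan _ (conjTranspose_mem_complexLindbladSpan (mem_complexLindbladSpan L i)))
      (hspan _ (mem_complexLindbladSpan L j)) (fun k => hQL k j) hne

theorem exists_isRecovery_probesGenerator (hcode : HasTwoProbeMarginals ψ ρ Q)
    (hψ : Orthonormal ℂ ψ) (hm : 2 ≤ m) (hρ : ∀ k, (ρ k).trace = 1) (hQ : ∀ k, (Q k).trace = 0)
    {L : Fin r → Matrix P P ℂ} (hQL : ∀ k i, (Q k * L i).trace = 0)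
    (hnoise : ∀ S ∈ lindbladSpan L, ((ρ 0 - ρ 1) * S).trace = 0) :
    ∃ R, IsRecovery ψ R ∧ ∀ H (ω : ℝ) X, codeProj ψ * X * codeProj ψ = X →
      qecOperation ψ R (probesGenerator H L ω X)
        = hamiltonianGenerator ((ω * m * ((ρ 0 - ρ 1) * H).trace / 2 : ℂ) • logicalZ ψ) X := by
  have hspan : ∀ X ∈ complexLindbladSpan L, (ρ 0 * X).trace = (ρ 1 * X).trace := fun X hX => by
    simpa only [sub_mul, Matrix.trace_sub, sub_eq_zero] using
      trace_mul_eq_zero_of_mem_complexLindbladSpan hnoise hX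
  obtain ⟨R, hR, hRL⟩ := exists_isRecovery_lindbladian hψ
    (J := fun a : Fin r × Fin m => onProbe a.2 (L a.1))
    (fun a => hcode.isScalarOnCode_onProbe hm hρ hQ (hspan _ (mem_complexLindbladSpan L a.1)) a.2)
    (fun a b => hcode.isScalarOnCode_conjTranspose_onProbe_mul_onProbe hm hρ hQ hQL hspan
      a.1 b.1 a.2 b.2)
  refine ⟨R, hR, fun H ω X hX => ?_⟩
  have hG : codeProj ψ * ((ω : ℂ) • ∑ ℓ : Fin m, onProbe ℓ H) * codeProj ψ
      = (ω * m * ((ρ 0 + ρ 1) * H).trace / 2 : ℂ) • codeProj ψ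
        + (ω * m * ((ρ 0 - ρ 1) * H).trace / 2 : ℂ) • logicalZ ψ := by
    rw [Matrix.mul_smul, Matrix.smul_mul, hcode.codeProj_mul_sum_onProbe_mul_codeProj hm hρ hQ]
    module
  rw [probesGenerator, hRL _ X hX, hG,
    comm_smul_add (isStarProjection_codeProj hψ).isIdempotentElem hX, hamiltonianGenerator_apply]

end HasTwoProbeMarginals

end CodeConditions

end MultiProbe

theorem lemmaS1_general {P A : Type*} [Fintype P] [DecidableEq P] [Fintype A] [DecidableEq A]
    {r m : ℕ} (hm : 2 ≤ m) (H : Matrix P P ℂ) {L : Fin r → Matrix P P ℂ}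
    {ρ : Fin 2 → Matrix P P ℂ} (hρ : ∀ k, (ρ k).trace = 1)
    (hnoise : ∀ S ∈ MultiProbe.lindbladSpan L, ((ρ 0 - ρ 1) * S).trace = 0)
    {Q : Fin 2 → Matrix P P ℂ} (hQ : ∀ k, (Q k).trace = 0) (hQL : ∀ k i, (Q k * L i).trace = 0)
    {ψ : Fin 2 → EuclideanSpace ℂ ((Fin m → P) × A)} (hψ : Orthonormal ℂ ψ)
    (hcode : MultiProbe.HasTwoProbeMarginals ψ ρ Q) :
    ∃ R : Matrix ((Fin m → P) × A) ((Fin m → P) × A) ℂ →ₗ[ℂ]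
        Matrix ((Fin m → P) × A) ((Fin m → P) × A) ℂ,
      MultiProbe.IsRecovery ψ R ∧
      ∀ (ω T ε : ℝ), 0 < ε → ∃ δ > 0,
        ∀ σ₀ : Matrix ((Fin m → P) × A) ((Fin m → P) × A) ℂ,
          MultiProbe.IsLogicalState ψ σ₀ →
          ∃ σ : ℝ → Matrix ((Fin m → P) × A) ((Fin m → P) × A) ℂ,
            σ 0 = σ₀ ∧
            (∀ t : ℝ, HasDerivAt σ ((-Complex.I) • MultiProbe.comm
              ((ω * m * ((ρ 0 - ρ 1) * H).trace / 2 : ℂ) • MultiProbe.logicalZ ψ) (σ t)) t) ∧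
            ∀ (τ : ℝ) (N : ℕ), 0 < τ → τ ≤ δ → N * τ ≤ T →
              ‖MultiProbe.qecState ψ R (MultiProbe.probesGenerator H L ω) τ N σ₀
                - σ (N * τ)‖ ≤ ε := by
  obtain ⟨R, hR, hRL⟩ := hcode.exists_isRecovery_probesGenerator hψ hm hρ hQ hQL hnoise
  refine ⟨R, hR, fun ω T ε hε => ?_⟩
  obtain ⟨δ, hδ, hclose⟩ := MultiProbe.exists_norm_qecState_sub_evolve_le hψ hR
    (hRL H ω) T hε
  refine ⟨δ, hδ, fun σ₀ hσ₀ => ?_⟩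
  obtain ⟨hzero, hderiv⟩ := MultiProbe.evolve_spec (MultiProbe.hamiltonianGenerator
    ((ω * m * ((ρ 0 - ρ 1) * H).trace / 2 : ℂ) • MultiProbe.logicalZ ψ)) σ₀
  simp only [MultiProbe.hamiltonianGenerator_apply] at hderiv
  exact ⟨_, hzero, hderiv, hclose σ₀ hσ₀⟩

theorem lemmaS1 {P A : Type*} [Fintype P] [DecidableEq P] [Fintype A] [DecidableEq A]
    {r m : ℕ} (hm : 2 ≤ m)
    (H : Matrix P P ℂ) (hH : H.IsHermitian) (L : Fin r → Matrix P P ℂ)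
    (ρ : Fin 2 → Matrix P P ℂ) (hρ : MultiProbe.IsOptimalPair H L ρ)
    (Q : Fin 2 → Matrix P P ℂ) (hQherm : ∀ k, (Q k).IsHermitian)
    (hQtrace : ∀ k, (Q k).trace = 0) (hQL : ∀ k i, (Q k * L i).trace = 0)
    (ψ : Fin 2 → EuclideanSpace ℂ ((Fin m → P) × A)) (hψ : Orthonormal ℂ ψ)
    (hcode : ∀ (k k' : Fin 2) (ℓ ℓ' : Fin m), ℓ ≠ ℓ' →
      MultiProbe.reduceTwo ℓ ℓ' (MultiProbe.ketBra (ψ k) (ψ k')) =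
        if k = k' then ρ k ⊗ₖ ρ k - Q k ⊗ₖ Q k else 0) :
    ∃ R : Matrix ((Fin m → P) × A) ((Fin m → P) × A) ℂ →ₗ[ℂ]
        Matrix ((Fin m → P) × A) ((Fin m → P) × A) ℂ,
      MultiProbe.IsRecovery ψ R ∧
      ∀ (ω T ε : ℝ), 0 < ε → ∃ δ > 0,
        ∀ σ₀ : Matrix ((Fin m → P) × A) ((Fin m → P) × A) ℂ,
          MultiProbe.IsLogicalState ψ σ₀ →
          ∃ σ : ℝ → Matrix ((Fin m → P) × A) ((Fin m → P) × A) ℂ,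
            σ 0 = σ₀ ∧
            (∀ t : ℝ, HasDerivAt σ ((-Complex.I) • MultiProbe.comm
              (((ω * m * MultiProbe.distSpan H L : ℝ) : ℂ) • MultiProbe.logicalZ ψ) (σ t)) t) ∧
            ∀ (τ : ℝ) (N : ℕ), 0 < τ → τ ≤ δ → N * τ ≤ T →
              ‖MultiProbe.qecState ψ R (MultiProbe.probesGenerator H L ω) τ N σ₀
                - σ (N * τ)‖ ≤ ε := by
  have hfrequency (ω : ℝ) : (ω * m * ((ρ 0 - ρ 1) * H).trace / 2 : ℂ)
      = ((ω * m * MultiProbe.distSpan H L : ℝ) : ℂ) := by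
    rw [hρ.signal]
    push_cast
    ring
  simpa only [hfrequency] using
    lemmaS1_general hm H (fun k => (hρ.density k).2) hρ.noise hQtrace hQL hψ hcode
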